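/- Let $(\Omega,\mathcal B,\mu)$ be a $\sigma$-finite measure space, let $H$ be a complex Hilbert space and let $p\in(1,\infty)$. Write $L_q=L_q(\Omega,H)$ for the space of (classes of) Bochner measurable functions with $\|u\|_q=\big(\int_\Omega\|u(x)\|_H^q\,d\mu(x)\big)^{1/q}<\infty$, and for $u\colon\Omega\to H$ define $\operatorname{sgn}u\colon\Omega\to H$ by $(\operatorname{sgn}u)(x)=\|u(x)\|_H^{-1}u(x)$ if $u(x)\ne0$ and $(\operatorname{sgn}u)(x)=0$ if $u(x)=0$. Let $$C=\{u\in L_2\cap L_p:\ \|u\|_p\le 1\},$$ which is a non-empty closed convex subset of $L_2$, and let $P\colon L_2\to C$ be the orthogonal projection of $L_2$ onto $C$, that is, $Pf$ is the unique element of $C$ nearest to $f$ in $L_2$. Let $\mathcal V$ be a complex Hilbert space which is continuously and densely embedded in $L_2$. Let $\mathfrak a\colon\mathcal V\times\mathcal V\to\mathbb C$ be a sesquilinear form (linear in the first variable) that is continuous, i.e. there is $M>0$ with $|\mathfrak a(u,v)|\le M\|u\|_{\mathcal V}\|v\|_{\mathcal V}$ for all $u,v\in\mathcal V$, and elliptic,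 i.e. there are $\eta>0$ and $\omega\in\mathbb R$ with $\operatorname{Re}\mathfrak a(u,u)+\omega\|u\|_{L_2}^2\ge\eta\|u\|_{\mathcal V}^2$ for all $u\in\mathcal V$. Let $A$ be the operator in $L_2$ associated with $\mathfrak a$, that is, the operator with graph $$\{(u,f):\ u\in\mathcal V,\ f\in L_2,\ \mathfrak a(u,v)=(f,v)_{L_2}\text{ for all }v\in\mathcal V\},$$ and let $S=(S_t)_{t>0}$ be the $C_0$-semigroup on $L_2$ generated by $-A$. Then the following are equivalent. (i) $\|S_tu\|_p\le\|u\|_p$ for all $u\in L_2\cap L_p$ and all $t>0$. (ii) $P\mathcal V\subset\mathcal V$, and $\operatorname{Re}\mathfrak a\big(u,\|u\|_H^{p-1}\operatorname{sgn}u\big)\ge0$ for all $u\in\mathcal V$ with $\|u\|_H^{p-1}\operatorname{sgn}u\in\mathcal V$. -/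

import Mathlib

open MeasureTheory Filter Topology
open scoped ENNReal NNReal

noncomputable section

namespace LpContractivity

/-! ### Strongly continuous semigroups and their generators -/

/-- A `C₀`-semigroup of bounded linear operators on a complex normed space. -/
structure C0Semigroup (E : Type*) [NormedAddCommGroup E] [NormedSpace ℂ E] where
  /-- The operator at time `t ≥ 0`. -/
  op : ℝ≥0 → E →L[ℂ] E
  op_zero : op 0 = ContinuousLinearMap.id ℂ E
  op_add : ∀ s t : ℝ≥0, op (s + t) = (op s).comp (op t)
  tendsto_zero : ∀ x : E, Tendsto (fun t : ℝ≥0 => op t x) (𝓝[>] 0) (𝓝 x)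

namespace C0Semigroup

variable {E : Type*} [NormedAddCommGroup E] [NormedSpace ℂ E]

/-- The difference quotient `t⁻¹ (S_t x - x)`. -/
def quot (S : C0Semigroup E) (t : ℝ≥0) (x : E) : E := (((t : ℝ)⁻¹ : ℝ) : ℂ) • (S.op t x - x)

theorem quot_add (S : C0Semigroup E) (t : ℝ≥0) (x y : E) :
    S.quot t (x + y) = S.quot t x + S.quot t y := by
  simp only [quot, map_add, ← smul_add]
  congr 1
  abel

theorem quot_smul (S : C0Semigroup E) (t : ℝ≥0) (c : ℂ) (x : E) :
    S.quot t (c • x) = c • S.quot t x := by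
  simp only [quot, map_smul, ← smul_sub, smul_comm c]

/-- The (infinitesimal) generator of `S`: its domain consists of all `x` for which
`lim_{t ↓ 0} t⁻¹ (S_t x - x)` exists, and it maps `x` to this limit. -/
def generator (S : C0Semigroup E) : E →ₗ.[ℂ] E where
  domain :=
    { carrier := {x | ∃ y, Tendsto (fun t : ℝ≥0 => S.quot t x) (𝓝[>] 0) (𝓝 y)}
      add_mem' := by
        rintro x x' ⟨y, hy⟩ ⟨y', hy'⟩
        exact ⟨y + y', by simpa only [quot_add] using hy.add hy'⟩
      zero_mem' := ⟨0, by simp [quot]⟩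
      smul_mem' := by
        rintro c x ⟨y, hy⟩
        exact ⟨c • y, by simpa only [quot_smul] using hy.const_smul c⟩ }
  toFun :=
    { toFun := fun x => x.2.choose
      map_add' := fun x x' => by
        refine tendsto_nhds_unique (x + x').2.choose_spec ?_
        simpa only [quot_add, Submodule.coe_add] using x.2.choose_spec.add x'.2.choose_spec
      map_smul' := fun c x => by
        refine tendsto_nhds_unique (c • x).2.choose_spec ?_
        simpa only [quot_smul, Submodule.coe_smul, RingHom.id_apply] using
          x.2.choose_spec.const_smul c }

theorem mem_graph_generator (S : C0Semigroup E) (x y : E) :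
    (x, y) ∈ S.generator.graph ↔ Tendsto (fun t : ℝ≥0 => S.quot t x) (𝓝[>] 0) (𝓝 y) := by
  rw [LinearPMap.mem_graph_iff]
  constructor
  · rintro ⟨z, rfl, rfl⟩
    exact z.2.choose_spec
  · intro h
    have hx : x ∈ S.generator.domain := ⟨y, h⟩
    exact ⟨⟨x, hx⟩, rfl, tendsto_nhds_unique (Exists.choose_spec hx) h⟩

end C0Semigroup

/-! ### Sesquilinear forms and their associated operators

Forms `a : V →ₗ[ℂ] V →ₗ⋆[ℂ] ℂ` are linear in the first and antilinear in the second variable.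
The space `V` is embedded in the Hilbert space `E` by `j`. The inner product of `E` that is linear
in its first variable is `(f, g) = inner ℂ g f`. -/

section Forms

variable {V E : Type*} [NormedAddCommGroup V] [InnerProductSpace ℂ V]
  [NormedAddCommGroup E] [InnerProductSpace ℂ E]

/-- Continuity of a form: `|a(u,v)| ≤ M ‖u‖ ‖v‖`. -/
def IsContinuousForm (a : V →ₗ[ℂ] V →ₗ⋆[ℂ] ℂ) : Prop :=
  ∃ M : ℝ, 0 < M ∧ ∀ u v : V, ‖a u v‖ ≤ M * ‖u‖ * ‖v‖

/-- Ellipticity of a form with respect to the embedding `j`: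
`Re a(u,u) + ω ‖j u‖² ≥ η ‖u‖²` for some `η > 0` and `ω ∈ ℝ`. -/
def IsEllipticForm (j : V →L[ℂ] E) (a : V →ₗ[ℂ] V →ₗ⋆[ℂ] ℂ) : Prop :=
  ∃ η ω : ℝ, 0 < η ∧ ∀ u : V, η * ‖u‖ ^ 2 ≤ (a u u).re + ω * ‖j u‖ ^ 2

/-- The set of all pairs `(j u, f)` with `u ∈ V`, `f ∈ E` and `a(u,v) = (f, j v)` for all
`v ∈ V`. -/
def formGraph (j : V →L[ℂ] E) (a : V →ₗ[ℂ] V →ₗ⋆[ℂ] ℂ) : Submodule ℂ (E × E) where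
  carrier := {q | ∃ u : V, j u = q.1 ∧ ∀ v : V, a u v = inner ℂ (j v) q.2}
  add_mem' := by
    rintro q r ⟨u, hu, hu'⟩ ⟨w, hw, hw'⟩
    exact ⟨u + w, by simp [hu, hw], fun v => by simp [hu', hw']⟩
  zero_mem' := ⟨0, by simp, fun v => by simp⟩
  smul_mem' := by
    rintro c q ⟨u, hu, hu'⟩
    exact ⟨c • u, by simp [hu], fun v => by simp [hu']⟩

/-- The operator in `E` associated with the form `a`, that is, the operator whose graph is
`formGraph j a`; see `graph_formOperator`. -/
def formOperator (j : V →L[ℂ] E) (a : V →ₗ[ℂ] V →ₗ⋆[ℂ] ℂ) : E →ₗ.[ℂ] E :=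
  (formGraph j a).toLinearPMap

theorem graph_formOperator (j : V →L[ℂ] E) (hinj : Function.Injective j) (hd : DenseRange j)
    (a : V →ₗ[ℂ] V →ₗ⋆[ℂ] ℂ) : (formOperator j a).graph = formGraph j a := by
  apply Submodule.toLinearPMap_graph_eq
  rintro ⟨x, f⟩ ⟨u, hu, hu'⟩ (rfl : x = 0)
  have hu0 : u = 0 := hinj (by simpa using hu)
  subst hu0
  refine hd.eq_zero_of_inner_right ℂ ?_
  intro v
  simpa using (hu' v).symm

end Forms

/-! ### The `L_p` unit ball in `L₂(Ω, H)` and its orthogonal projection -/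

section Ball

variable {Ω : Type*} [MeasurableSpace Ω] (μ : Measure Ω)
  (H : Type*) [NormedAddCommGroup H] [InnerProductSpace ℂ H]

/-- The set of all `u ∈ L₂(Ω, H) ∩ L_p(Ω, H)` with `‖u‖_p ≤ 1`. -/
def lpBall (p : ℝ) : Set (Lp H 2 μ) :=
  {u | MemLp u (ENNReal.ofReal p) μ ∧ eLpNorm u (ENNReal.ofReal p) μ ≤ 1}

theorem lpBall_nonempty (p : ℝ) : (lpBall μ H p).Nonempty := by
  refine ⟨0, ?_, ?_⟩
  · exact (memLp_congr_ae (Lp.coeFn_zero H 2 μ)).2 MemLp.zero'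
  · rw [eLpNorm_congr_ae (Lp.coeFn_zero H 2 μ)]
    simp

theorem convex_lpBall {p : ℝ} (hp : 1 < p) : Convex ℝ (lpBall μ H p) := by
  have hp1 : 1 ≤ ENNReal.ofReal p := by
    rw [← ENNReal.ofReal_one]
    exact ENNReal.ofReal_le_ofReal hp.le
  intro u hu v hv s t hs ht hst
  have key : eLpNorm (s • u + t • v : Lp H 2 μ) (ENNReal.ofReal p) μ ≤ 1 := by
    have h1 : (s • u + t • v : Lp H 2 μ) =ᵐ[μ] s • (u : Ω → H) + t • (v : Ω → H) := by
      filter_upwards [Lp.coeFn_add (s • u) (t • v), Lp.coeFn_smul s u, Lp.coeFn_smul t v]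
        with x h h' h''
      rw [h, Pi.add_apply, Pi.add_apply, h', h'']
    rw [eLpNorm_congr_ae h1]
    refine (eLpNorm_add_le (hu.1.1.const_smul s) (hv.1.1.const_smul t) hp1).trans ?_
    rw [eLpNorm_const_smul, eLpNorm_const_smul, ← ofReal_norm, ← ofReal_norm,
      Real.norm_of_nonneg hs, Real.norm_of_nonneg ht]
    calc ENNReal.ofReal s * eLpNorm u (ENNReal.ofReal p) μ
          + ENNReal.ofReal t * eLpNorm v (ENNReal.ofReal p) μ
        ≤ ENNReal.ofReal s * 1 + ENNReal.ofReal t * 1 := by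
          gcongr
          exacts [hu.2, hv.2]
      _ = 1 := by
          rw [mul_one, mul_one, ← ENNReal.ofReal_add hs ht, hst, ENNReal.ofReal_one]
  exact ⟨⟨Lp.aestronglyMeasurable _, key.trans_lt ENNReal.one_lt_top⟩, key⟩

theorem isClosed_lpBall (p : ℝ) : IsClosed (lpBall μ H p) := by
  rw [← isSeqClosed_iff_isClosed]
  intro f g hf hfg
  have key : eLpNorm g (ENNReal.ofReal p) μ ≤ 1 :=
    eLpNorm_le_of_tendstoInMeasure (Eventually.of_forall fun n => (hf n).2)
      (tendstoInMeasure_of_tendsto_Lp hfg) fun n => Lp.aestronglyMeasurable _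
  exact ⟨⟨Lp.aestronglyMeasurable _, key.trans_lt ENNReal.one_lt_top⟩, key⟩

variable [CompleteSpace H]

/-- Every `f ∈ L₂(Ω, H)` has a unique nearest point in the `L_p` unit ball. -/
theorem existsUnique_nearest {p : ℝ} (hp : 1 < p) (f : Lp H 2 μ) :
    ∃! u, u ∈ lpBall μ H p ∧ ∀ v ∈ lpBall μ H p, ‖f - u‖ ≤ ‖f - v‖ := by
  let _ : InnerProductSpace ℝ (Lp H 2 μ) := InnerProductSpace.rclikeToReal ℂ (Lp H 2 μ)
  have hc : Convex ℝ (lpBall μ H p) := convex_lpBall μ H hp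
  have hle : ∀ u ∈ lpBall μ H p, (∀ v ∈ lpBall μ H p, ‖f - u‖ ≤ ‖f - v‖) →
      ∀ w ∈ lpBall μ H p, inner ℝ (f - u) (w - u) ≤ 0 := by
    intro u hu h
    refine (norm_eq_iInf_iff_real_inner_le_zero hc hu).1 ?_
    have : Nonempty (lpBall μ H p) := ⟨⟨u, hu⟩⟩
    exact le_antisymm (le_ciInf fun w => h w w.2)
      (ciInf_le (f := fun w : lpBall μ H p => ‖f - w‖)
        ⟨0, Set.forall_mem_range.2 fun _ => norm_nonneg _⟩ ⟨u, hu⟩)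
  obtain ⟨u, hu, hu'⟩ := exists_norm_eq_iInf_of_complete_convex (lpBall_nonempty μ H p)
    (isClosed_lpBall μ H p).isComplete hc f
  refine ⟨u, ⟨hu, fun v hv => ?_⟩, ?_⟩
  · rw [hu']
    exact ciInf_le (f := fun w : lpBall μ H p => ‖f - w‖)
      ⟨0, Set.forall_mem_range.2 fun _ => norm_nonneg _⟩ ⟨v, hv⟩
  · rintro w ⟨hw, hw'⟩
    have h1 := hle w hw hw' u hu
    have h2 := (norm_eq_iInf_iff_real_inner_le_zero hc hu).1 hu' w hw
    have h3 : inner ℝ (w - u) (w - u) ≤ 0 := by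
      have e : inner ℝ (w - u) (w - u) = inner ℝ (f - u) (w - u) + inner ℝ (f - w) (u - w) := by
        have : w - u = (f - u) - (f - w) := by abel
        rw [← neg_sub w u, inner_neg_right, ← sub_eq_add_neg, ← inner_sub_left, ← this]
      linarith
    rw [real_inner_self_eq_norm_sq] at h3
    exact sub_eq_zero.1 (norm_eq_zero.1 (pow_eq_zero_iff two_ne_zero |>.1
      (le_antisymm h3 (sq_nonneg _))))

/-- The orthogonal projection of `L₂(Ω, H)` onto the closed convex set `lpBall μ H p`: it maps `f`
to the unique nearest point in this set. -/
def lpBallProj {p : ℝ} (hp : 1 < p) (f : Lp H 2 μ) : Lp H 2 μ :=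
  (existsUnique_nearest μ H hp f).choose

theorem lpBallProj_spec {p : ℝ} (hp : 1 < p) (f : Lp H 2 μ) :
    lpBallProj μ H hp f ∈ lpBall μ H p ∧
      ∀ v ∈ lpBall μ H p, ‖f - lpBallProj μ H hp f‖ ≤ ‖f - v‖ :=
  (existsUnique_nearest μ H hp f).choose_spec.1

end Ball

/-- The function `sgn`, applied to the value of a function at a point: `‖x‖⁻¹ x` for `x ≠ 0`;
at `x = 0` its value is `0`. -/
def sgn {H : Type*} [NormedAddCommGroup H] [InnerProductSpace ℂ H] (x : H) : H :=
  ((‖x‖⁻¹ : ℝ) : ℂ) • x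

end LpContractivity

end

noncomputable section

namespace LpContractivity

/-! ### Orbits of a `C₀`-semigroup -/

namespace C0Semigroup

variable {E : Type*} [NormedAddCommGroup E] [NormedSpace ℂ E]

/-! By homogeneity, `S_t` is an `L_p` contraction on `L_2 ∩ L_p` iff it leaves the closed convex
ball `C` invariant (`contraction_iff_mapsTo_lpBall`). Two facts turn this into a condition on the
form.

Ouhabaz' criterion (`invariant_iff`): `C` is invariant iff `P` preserves the form domain and `Re
a(Pu, u - Pu) ≥ 0`. If `C` is invariant, so are the operators `l (l + A)⁻¹` for large `l`. Applied
to `Pu` they give elements of `C` that stay bounded in `V` and converge to `Pu` in `L_2`, so `Pu`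
lies in `V`, and the inequality survives the weak limit. Conversely, the inequality and ellipticity
give a Gronwall estimate for the squared distance from an orbit to `C`, which therefore stays zero
if it starts at zero.

The geometry of `C` (`lpBallProj_eq`, `sub_lpBallProj`): the gradient of `‖x‖^p / p` is `‖x‖^(p-1)
sgn x`, so the outward normals at `u` with `‖u‖_p = 1` are the multiples `c ‖u‖^(p-1) sgn u`, `c ≥
0`. Hence, off `C`, `f - Pf` is such a multiple at `Pf`; and each normalized `u` whose normal lies
in `L_2` is the projection of `u` plus that normal. Up to positive factors, the pairs `(Pu, u - Pu)`
are thus the pairs `(u, ‖u‖^(p-1) sgn u)` of condition (ii). -/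

theorem tendsto_nhds_zero (S : C0Semigroup E) (x : E) :
    Tendsto (fun t : ℝ≥0 => S.op t x) (𝓝 0) (𝓝 x) := by
  have h0 : S.op 0 x = x := by simp [S.op_zero]
  have h : ContinuousWithinAt (fun t : ℝ≥0 => S.op t x) (Set.Ioi 0) 0 := by
    simpa [ContinuousWithinAt, h0] using S.tendsto_zero x
  rw [continuousWithinAt_Ioi_iff_Ici] at h
  have hu : Set.Ici (0 : ℝ≥0) = Set.univ := Set.eq_univ_of_forall fun _ => Set.mem_Ici.2 zero_le
  rw [hu, continuousWithinAt_univ] at h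
  simpa [ContinuousAt, h0] using h

/-- Otherwise there are times `t n → 0` with `‖S.op (t n)‖ > n`, although every orbit converges
along them; this contradicts uniform boundedness. -/
theorem exists_norm_op_le (S : C0Semigroup E) [CompleteSpace E] :
    ∃ δ : ℝ≥0, 0 < δ ∧ ∃ M : ℝ, ∀ t ≤ δ, ‖S.op t‖ ≤ M := by
  by_contra! h
  have h' : ∀ n : ℕ, ∃ t : ℝ≥0, t ≤ 1 / ((n : ℝ≥0) + 1) ∧ (n : ℝ) < ‖S.op t‖ :=
    fun n => h _ (by positivity) n
  choose t ht ht' using h'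
  have ht0 : Tendsto t atTop (𝓝 0) :=
    tendsto_of_tendsto_of_tendsto_of_le_of_le tendsto_const_nhds
      (NNReal.tendsto_coe.1 (by simpa using tendsto_one_div_add_atTop_nhds_zero_nat (𝕜 := ℝ)))
      (fun _ => zero_le) ht
  obtain ⟨C, hC⟩ := banach_steinhaus (g := fun n => S.op (t n)) fun x => by
    obtain ⟨C, hC⟩ := ((S.tendsto_nhds_zero x).comp ht0).norm.bddAbove_range
    exact ⟨C, fun n => hC ⟨n, rfl⟩⟩
  obtain ⟨n, hn⟩ := exists_nat_gt C
  linarith [hC n, ht' n]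

theorem op_add_apply (S : C0Semigroup E) (s t : ℝ≥0) (x : E) :
    S.op (s + t) x = S.op s (S.op t x) := by
  rw [S.op_add]; rfl

theorem continuous_orbit (S : C0Semigroup E) [CompleteSpace E] (x : E) :
    Continuous fun t : ℝ≥0 => S.op t x := by
  obtain ⟨δ, hδ, M, hM⟩ := S.exists_norm_op_le
  refine continuous_iff_continuousAt.2 fun t => ?_
  -- For `s ≤ t` near `t`, `S_s = S_(s-r) S_r` with `s - r ≤ δ`, so `K` bounds `‖S_s‖` uniformly.
  -- This gives left continuity. The subtraction is truncated, so `r = 0` when `t < δ`.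
  set r := t - δ
  set K := max ‖S.op t‖ (M * ‖S.op r‖)
  have hd : Tendsto (fun s => nndist s t) (𝓝 t) (𝓝 0) := by
    have : Continuous fun s => nndist s t := by fun_prop
    simpa using this.tendsto t
  have hlim : Tendsto (fun s => K * ‖S.op (nndist s t) x - x‖) (𝓝 t) (𝓝 0) := by
    have := ((((S.tendsto_nhds_zero x).comp hd).sub_const x).norm).const_mul K
    simpa using this
  refine tendsto_iff_norm_sub_tendsto_zero.2 (squeeze_zero' (.of_forall fun _ => norm_nonneg _)
    ?_ hlim)
  have hev : ∀ᶠ s in 𝓝 t, r ≤ s := by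
    rcases eq_or_ne t 0 with rfl | h0
    · exact .of_forall fun s => by simp [r]
    · exact (eventually_gt_nhds (tsub_lt_self (pos_iff_ne_zero.2 h0) hδ)).mono fun _ => le_of_lt
  filter_upwards [hev] with s hs
  rcases le_total t s with h | h
  · have e : nndist s t = s - t := by
      rw [← NNReal.coe_inj, coe_nndist, NNReal.dist_eq, NNReal.coe_sub h,
        abs_of_nonneg (sub_nonneg.2 (NNReal.coe_le_coe.2 h))]
    have e' : S.op s x = S.op t (S.op (s - t) x) := by
      rw [← S.op_add_apply, add_tsub_cancel_of_le h]
    rw [e, e', ← map_sub]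
    exact (ContinuousLinearMap.le_opNorm _ _).trans
      (mul_le_mul_of_nonneg_right (le_max_left _ _) (norm_nonneg _))
  · have e : nndist s t = t - s := by
      rw [nndist_comm, ← NNReal.coe_inj, coe_nndist, NNReal.dist_eq, NNReal.coe_sub h,
        abs_of_nonneg (sub_nonneg.2 (NNReal.coe_le_coe.2 h))]
    have e' : S.op t x = S.op s (S.op (t - s) x) := by
      rw [← S.op_add_apply, add_tsub_cancel_of_le h]
    have hsb : ‖S.op s‖ ≤ M * ‖S.op r‖ := by
      have : S.op s = (S.op (s - r)).comp (S.op r) := by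
        rw [← S.op_add, tsub_add_cancel_of_le hs]
      rw [this]
      refine (ContinuousLinearMap.opNorm_comp_le _ _).trans
        (mul_le_mul_of_nonneg_right (hM _ ?_) (norm_nonneg _))
      calc s - r ≤ t - r := tsub_le_tsub_right h _
        _ ≤ δ := tsub_le_iff_right.2 (by rw [add_comm]; exact tsub_le_iff_right.1 le_rfl)
    rw [e, e', norm_sub_rev, ← map_sub]
    exact (ContinuousLinearMap.le_opNorm _ _).trans
      (mul_le_mul_of_nonneg_right (hsb.trans (le_max_right _ _)) (norm_nonneg _))

theorem mem_graph_generator_op (S : C0Semigroup E) {x y : E} (h : (x, y) ∈ S.generator.graph)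
    (t : ℝ≥0) : (S.op t x, S.op t y) ∈ S.generator.graph := by
  rw [mem_graph_generator] at h ⊢
  refine (((S.op t).continuous.tendsto y).comp h).congr fun s => ?_
  simp only [Function.comp_apply, quot, map_smul, map_sub]
  rw [← S.op_add_apply, ← S.op_add_apply, add_comm]

/-- The difference quotient at `t` is the one at `0` for the point `S_t x`, which is again in the
domain. The right derivative is all that Gronwall's inequality needs. -/
theorem hasDerivWithinAt_orbit (S : C0Semigroup E) {x y : E}
    (h : (x, y) ∈ S.generator.graph) {t : ℝ} (ht : 0 ≤ t) :
    HasDerivWithinAt (fun s : ℝ => S.op s.toNNReal x) (S.op t.toNNReal y) (Set.Ici t) t := by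
  have h' := S.mem_graph_generator_op h t.toNNReal
  rw [mem_graph_generator] at h'
  rw [hasDerivWithinAt_iff_tendsto_slope, Set.Ici_sdiff_left]
  have hm : Tendsto (fun s : ℝ => (s - t).toNNReal) (𝓝[>] t) (𝓝[>] 0) := by
    refine tendsto_nhdsWithin_iff.2 ⟨?_, ?_⟩
    · have : Continuous fun s : ℝ => (s - t).toNNReal := by fun_prop
      simpa using (this.tendsto t).mono_left nhdsWithin_le_nhds
    · filter_upwards [self_mem_nhdsWithin] with s hs
      simpa using hs
  refine (h'.comp hm).congr' ?_
  filter_upwards [self_mem_nhdsWithin] with s hs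
  have hs' : t < s := hs
  have e : s.toNNReal = (s - t).toNNReal + t.toNNReal := by
    rw [← Real.toNNReal_add (by linarith) ht, sub_add_cancel]
  rw [slope_def_module, e, S.op_add_apply]
  simp only [Function.comp_apply, quot, Complex.coe_smul]
  rw [Real.coe_toNNReal _ (by linarith)]

end C0Semigroup

/-! ### Resolvents of operators associated with elliptic forms -/

section Resolvent

variable {V E : Type*} [NormedAddCommGroup V] [InnerProductSpace ℂ V] [CompleteSpace V]
  [NormedAddCommGroup E] [InnerProductSpace ℂ E] [CompleteSpace E]

/-- The Lax–Milgram theorem for the form `a(u,v) + l (j u, j v)`. -/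
theorem exists_resolvent (j : V →L[ℂ] E) (a : V →ₗ[ℂ] V →ₗ⋆[ℂ] ℂ) (ha : IsContinuousForm a)
    {η l : ℝ} (hη : 0 < η) (hell : ∀ u : V, η * ‖u‖ ^ 2 ≤ (a u u).re + l * ‖j u‖ ^ 2) (f : E) :
    ∃ u : V, ∀ v : V, a u v + l * inner ℂ (j v) (j u) = inner ℂ (j v) f := by
  obtain ⟨M, hM, hMa⟩ := ha
  let _ : InnerProductSpace ℝ V := InnerProductSpace.rclikeToReal ℂ V
  let b : V →ₗ[ℝ] V →ₗ[ℝ] ℝ := LinearMap.mk₂ ℝ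
    (fun u v => (a u v + l * inner ℂ (j v) (j u)).re)
    (fun u u' v => by simp; ring)
    (fun c u v => by
      rw [← Complex.coe_smul]; simp [-Complex.coe_smul]; ring)
    (fun u v v' => by simp; ring)
    (fun c u v => by
      rw [← Complex.coe_smul]; simp [-Complex.coe_smul]; ring)
  have hbdd : ∀ u v, ‖b u v‖ ≤ (M + |l| * (‖j‖ * ‖j‖)) * ‖u‖ * ‖v‖ := fun u v => by
    rw [Real.norm_eq_abs]
    calc |b u v| ≤ ‖a u v + l * inner ℂ (j v) (j u)‖ :=
          Complex.abs_re_le_norm (a u v + l * inner ℂ (j v) (j u))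
      _ ≤ ‖a u v‖ + |l| * (‖j v‖ * ‖j u‖) := by
        refine (norm_add_le _ _).trans (add_le_add le_rfl ?_)
        rw [norm_mul, Complex.norm_real, Real.norm_eq_abs]
        exact mul_le_mul_of_nonneg_left (norm_inner_le_norm _ _) (abs_nonneg _)
      _ ≤ M * ‖u‖ * ‖v‖ + |l| * ((‖j‖ * ‖v‖) * (‖j‖ * ‖u‖)) := by
        gcongr
        exacts [hMa u v, j.le_opNorm v, j.le_opNorm u]
      _ = _ := by ring
  let B : V →L[ℝ] V →L[ℝ] ℝ := LinearMap.mkContinuous₂ b _ hbdd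
  have hB : IsCoercive B := ⟨η, hη, fun u => by
    have := hell u
    have e : (l * inner ℂ (j u) (j u) : ℂ).re = l * ‖j u‖ ^ 2 := by
      rw [inner_self_eq_norm_sq_to_K, Complex.re_ofReal_mul]
      norm_cast
    change η * ‖u‖ * ‖u‖ ≤ (a u u + l * inner ℂ (j u) (j u)).re
    rw [Complex.add_re, e]
    linarith⟩
  set g : V := ContinuousLinearMap.adjoint j f
  set u := hB.continuousLinearEquivOfBilin.symm g
  have hre : ∀ v, (a u v + l * inner ℂ (j v) (j u)).re = (inner ℂ (j v) f).re := fun v => by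
    have h1 : inner ℝ (hB.continuousLinearEquivOfBilin u) v = B u v :=
      hB.continuousLinearEquivOfBilin_apply u v
    rw [ContinuousLinearEquiv.apply_symm_apply] at h1
    have h2 : inner ℝ g v = (inner ℂ g v).re := rfl
    rw [h2, ContinuousLinearMap.adjoint_inner_left, ← inner_conj_symm, Complex.conj_re] at h1
    exact h1.symm
  refine ⟨u, fun v => Complex.ext (hre v) ?_⟩
  -- Both sides are antilinear in `v`, so the real parts at `I • v` are the imaginary parts at `v`.
  have := hre (Complex.I • v)
  simpa [inner_smul_left] using this

/-- If `f` is orthogonal to the domain, solve the resolvent equation for `f`. Its solution `u` is in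
the domain, so testing with `u` itself and using ellipticity gives `u = 0`; then `f` is orthogonal
to the dense range of `j`. -/
theorem dense_formOperator_domain (j : V →L[ℂ] E) (hj : DenseRange j)
    (a : V →ₗ[ℂ] V →ₗ⋆[ℂ] ℂ) (ha : IsContinuousForm a) (hell : IsEllipticForm j a) :
    Dense {x : E | ∃ y, (x, y) ∈ formGraph j a} := by
  obtain ⟨η, ω, hη, h⟩ := hell
  let K : Submodule ℂ E := (formGraph j a).map (LinearMap.fst ℂ E E)
  have hK : {x : E | ∃ y, (x, y) ∈ formGraph j a} = K := by
    ext x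
    simp [K]
  rw [hK, Submodule.dense_iff_topologicalClosure_eq_top, Submodule.topologicalClosure_eq_top_iff,
    Submodule.eq_bot_iff]
  intro f hf
  obtain ⟨u, hu⟩ := exists_resolvent j a ha hη h f
  have hmem : j u ∈ K := ⟨(j u, f - (ω : ℂ) • j u), ⟨u, rfl, fun v => by
    rw [inner_sub_right, inner_smul_right, ← hu v, add_sub_cancel_right]⟩, rfl⟩
  have h0 := (K.mem_orthogonal f).1 hf _ hmem
  have h1 := congrArg Complex.re ((hu u).trans h0)
  have e : (ω * inner ℂ (j u) (j u) : ℂ).re = ω * ‖j u‖ ^ 2 := by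
    rw [inner_self_eq_norm_sq_to_K, Complex.re_ofReal_mul]
    norm_cast
  rw [Complex.add_re, e, Complex.zero_re] at h1
  have h2 := h u
  rw [h1] at h2
  have hu0 : u = 0 := by
    have : ‖u‖ ^ 2 ≤ 0 := by nlinarith [sq_nonneg ‖u‖]
    simpa using this
  refine hj.eq_zero_of_inner_right ℂ fun v => ?_
  simpa [hu0] using (hu v).symm

/-- A bounded family in `V` whose image converges in `E` has, along some ultrafilter, a weak limit
in `V`. -/
theorem exists_weak_limit {ι : Type*} {F : Filter ι} [F.NeBot] (j : V →L[ℂ] E) {w : ι → V} {R : ℝ}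
    (hw : ∀ᶠ i in F, ‖w i‖ ≤ R) {z : E} (hz : Tendsto (fun i => j (w i)) F (𝓝 z)) :
    ∃ (v : V) (G : Filter ι), G.NeBot ∧ G ≤ F ∧ j v = z ∧
      ∀ φ : V →L[ℂ] ℂ, Tendsto (fun i => φ (w i)) G (𝓝 (φ v)) := by
  -- Along an ultrafilter all the bounded scalars `inner ℂ (w i) h` converge at once. The limit is a
  -- bounded linear functional of `h`, represented by some `v` through Riesz.
  let G : Ultrafilter ι := Ultrafilter.of F
  have hGF : (G : Filter ι) ≤ F := Ultrafilter.of_le F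
  have hlim : ∀ h : V, ∃ c : ℂ, ‖c‖ ≤ R * ‖h‖ ∧ Tendsto (fun i => inner ℂ (w i) h) G (𝓝 c) := by
    intro h
    have hb : ∀ᶠ i in (G : Filter ι), inner ℂ (w i) h ∈ Metric.closedBall (0 : ℂ) (R * ‖h‖) := by
      filter_upwards [hGF hw] with i hi
      rw [mem_closedBall_zero_iff]
      exact (norm_inner_le_norm _ _).trans (mul_le_mul_of_nonneg_right hi (norm_nonneg _))
    obtain ⟨c, hc, hc'⟩ := (isCompact_closedBall (0 : ℂ) (R * ‖h‖)).ultrafilter_le_nhds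
      (G.map fun i => inner ℂ (w i) h) (le_principal_iff.2 hb)
    exact ⟨c, by simpa using hc, hc'⟩
  choose ℓ hℓ hℓ' using hlim
  let L : V →ₗ[ℂ] ℂ :=
    { toFun := ℓ
      map_add' := fun x y => tendsto_nhds_unique (hℓ' (x + y))
        (by simpa only [inner_add_right] using (hℓ' x).add (hℓ' y))
      map_smul' := fun c x => tendsto_nhds_unique (hℓ' (c • x))
        (by simpa only [inner_smul_right, smul_eq_mul, RingHom.id_apply] using (hℓ' x).const_mul c) }
  let Lc : V →L[ℂ] ℂ := L.mkContinuous R hℓ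
  set v : V := (InnerProductSpace.toDual ℂ V).symm Lc
  have hv : ∀ h, Tendsto (fun i => inner ℂ (w i) h) G (𝓝 (inner ℂ v h)) := fun h => by
    have : inner ℂ v h = ℓ h := InnerProductSpace.toDual_symm_apply
    rw [this]
    exact hℓ' h
  have hv' : ∀ h, Tendsto (fun i => inner ℂ h (w i)) G (𝓝 (inner ℂ h v)) := fun h => by
    have := (Complex.continuous_conj.tendsto _).comp (hv h)
    simpa only [Function.comp_def, inner_conj_symm] using this
  refine ⟨v, G, inferInstance, hGF, ?_, fun φ => ?_⟩
  · refine ext_inner_left ℂ fun g => ?_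
    refine tendsto_nhds_unique ?_ (tendsto_const_nhds.inner (𝕜 := ℂ) (hz.mono_left hGF) : Tendsto
      (fun i => inner ℂ g (j (w i))) G (𝓝 (inner ℂ g z)))
    simpa only [ContinuousLinearMap.adjoint_inner_left] using
      hv' (ContinuousLinearMap.adjoint j g)
  · have e : ∀ x, φ x = inner ℂ ((InnerProductSpace.toDual ℂ V).symm φ) x := fun x =>
      InnerProductSpace.toDual_symm_apply.symm
    simp only [e]
    exact hv' _

end Resolvent

/-! ### Invariance of closed convex sets -/

section Invariance

variable {E : Type*} [NormedAddCommGroup E] [InnerProductSpace ℂ E]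

theorem re_inner_le_zero_of_nearest {C : Set E} (hC : Convex ℝ C) {f u : E} (hu : u ∈ C)
    (h : ∀ v ∈ C, ‖f - u‖ ≤ ‖f - v‖) {v : E} (hv : v ∈ C) :
    (inner ℂ (f - u) (v - u)).re ≤ 0 := by
  let _ : InnerProductSpace ℝ E := InnerProductSpace.rclikeToReal ℂ E
  have : Nonempty C := ⟨⟨u, hu⟩⟩
  exact (norm_eq_iInf_iff_real_inner_le_zero (F := E) hC hu).1
    (le_antisymm (le_ciInf fun w => h w w.2) (ciInf_le (f := fun w : C => ‖f - w‖)
      ⟨0, Set.forall_mem_range.2 fun _ => norm_nonneg _⟩ ⟨u, hu⟩)) v hv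

theorem norm_sub_le_of_re_inner_le_zero {f u v : E} (h : (inner ℂ (f - u) (v - u)).re ≤ 0) :
    ‖f - u‖ ≤ ‖f - v‖ := by
  have e : f - v = (f - u) - (v - u) := by abel
  have h1 : ‖f - v‖ ^ 2 = ‖f - u‖ ^ 2 - 2 * (inner ℂ (f - u) (v - u)).re + ‖v - u‖ ^ 2 := by
    rw [e]; exact norm_sub_sq (𝕜 := ℂ) _ _
  exact (sq_le_sq₀ (norm_nonneg _) (norm_nonneg _)).1 (by nlinarith [sq_nonneg ‖v - u‖])

theorem continuous_norm_sub_nearest {E : Type*} [NormedAddCommGroup E] {C : Set E}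
    {P : E → E} (hP : ∀ f, P f ∈ C ∧ ∀ v ∈ C, ‖f - P f‖ ≤ ‖f - v‖) : Continuous fun x => ‖x - P x‖ := by
  have key : ∀ x y, ‖x - P x‖ ≤ ‖y - P y‖ + ‖x - y‖ := fun x y => by
    calc ‖x - P x‖ ≤ ‖x - P y‖ := (hP x).2 _ (hP y).1
      _ = ‖(y - P y) + (x - y)‖ := by congr 1; abel
      _ ≤ _ := norm_add_le _ _
  refine (LipschitzWith.of_le_add fun x y => ?_ : LipschitzWith 1 _).continuous
  rw [dist_eq_norm]
  exact key x y

/-- If a semigroup leaves a closed convex set invariant, then so does the resolvent of its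
generator. -/
theorem resolvent_mem_of_invariant {C : Set E} {P : E → E} (hC : Convex ℝ C)
    (hP : ∀ f, P f ∈ C ∧ ∀ v ∈ C, ‖f - P f‖ ≤ ‖f - v‖) (S : C0Semigroup E) {ω : ℝ}
    (hbd : ∀ x t, ‖S.op t x‖ ≤ Real.exp (ω * t) * ‖x‖)
    (hinv : ∀ x ∈ C, ∀ t : ℝ≥0, 0 < t → S.op t x ∈ C) {l : ℝ} (hl : ω < l) (hl0 : 0 ≤ l)
    {w f : E} (hf : f ∈ C) (hw : (w, (l : ℂ) • (w - f)) ∈ S.generator.graph) : w ∈ C := by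
  -- Split `S_t w - w` into the increments of `w - z` and of `z`. Paired with `w - z`, the latter is
  -- nonpositive because `S_t z ∈ C`, the former is at most `(e^(ωt) - 1) ‖w - z‖²`. In the limit `l
  -- Re(w - z, w - f) ≤ ω ‖w - z‖²`; since `f ∈ C` and `l > ω`, this forces `w = z`.
  set z := P w
  have hlim := (C0Semigroup.mem_graph_generator _ _ _).1 hw
  have hlim' : Tendsto (fun t => (inner ℂ (w - z) (S.quot t w)).re) (𝓝[>] 0)
      (𝓝 (inner ℂ (w - z) ((l : ℂ) • (w - f))).re) :=
    (Complex.continuous_re.tendsto _).comp (tendsto_const_nhds.inner hlim)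
  have hexp : Tendsto (fun t : ℝ≥0 => ((t : ℝ)⁻¹ * (Real.exp (ω * t) - 1)) * ‖w - z‖ ^ 2)
      (𝓝[>] 0) (𝓝 (ω * ‖w - z‖ ^ 2)) := by
    have hd : HasDerivAt (fun t : ℝ => Real.exp (ω * t)) ω 0 := by
      simpa using ((hasDerivAt_id (0 : ℝ)).const_mul ω).exp
    rw [hasDerivAt_iff_tendsto_slope] at hd
    have hc : Tendsto (fun t : ℝ≥0 => (t : ℝ)) (𝓝[>] 0) (𝓝[≠] 0) := by
      refine tendsto_nhdsWithin_iff.2 ⟨?_, ?_⟩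
      · exact (NNReal.continuous_coe.tendsto' 0 0 rfl).mono_left nhdsWithin_le_nhds
      · filter_upwards [self_mem_nhdsWithin] with t ht
        exact NNReal.coe_ne_zero.2 (ne_of_gt ht)
    refine ((hd.comp hc).mul_const _).congr fun t => ?_
    simp [slope_def_module]
  have hle := le_of_tendsto_of_tendsto hlim' hexp (by
    filter_upwards [self_mem_nhdsWithin] with t ht
    have hz : (inner ℂ (w - z) (S.op t z - z)).re ≤ 0 :=
      re_inner_le_zero_of_nearest hC (hP w).1 (hP w).2 (hinv z (hP w).1 t ht)
    have h1 : (inner ℂ (w - z) (S.op t (w - z))).re ≤ Real.exp (ω * t) * ‖w - z‖ ^ 2 := by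
      calc (inner ℂ (w - z) (S.op t (w - z))).re ≤ ‖w - z‖ * ‖S.op t (w - z)‖ :=
            re_inner_le_norm (𝕜 := ℂ) _ _
        _ ≤ ‖w - z‖ * (Real.exp (ω * t) * ‖w - z‖) := by gcongr; exact hbd _ _
        _ = _ := by ring
    have h2 : (inner ℂ (w - z) (w - z)).re = ‖w - z‖ ^ 2 := inner_self_eq_norm_sq (𝕜 := ℂ) _
    have h3 : S.op t w - w = (S.op t (w - z) - (w - z)) + (S.op t z - z) := by
      rw [map_sub]; abel
    have h4 : (inner ℂ (w - z) (S.op t w - w)).re ≤ (Real.exp (ω * t) - 1) * ‖w - z‖ ^ 2 := by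
      rw [h3, inner_add_right, inner_sub_right, Complex.add_re, Complex.sub_re]
      linarith
    rw [C0Semigroup.quot, inner_smul_right, Complex.re_ofReal_mul, mul_assoc]
    exact mul_le_mul_of_nonneg_left h4 (by positivity))
  have h5 : (inner ℂ (w - z) (f - z)).re ≤ 0 :=
    re_inner_le_zero_of_nearest hC (hP w).1 (hP w).2 hf
  have h6 : (inner ℂ (w - z) (w - z)).re = ‖w - z‖ ^ 2 := inner_self_eq_norm_sq (𝕜 := ℂ) _
  have h7 : w - f = (w - z) - (f - z) := by abel
  rw [inner_smul_right, Complex.re_ofReal_mul, h7, inner_sub_right, Complex.sub_re, h6] at hle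
  have h8 : ‖w - z‖ ^ 2 ≤ 0 := by nlinarith [sq_nonneg ‖w - z‖, mul_nonneg hl0 (neg_nonneg.2 h5)]
  have h9 : w = z := sub_eq_zero.1 (by simpa using h8)
  rw [h9]
  exact (hP w).1

variable {V : Type*} [NormedAddCommGroup V] [InnerProductSpace ℂ V] [CompleteSpace V]
  [CompleteSpace E]

/-- The distance to a set from an orbit grows at most exponentially. -/
theorem norm_sub_nearest_orbit_le {C : Set E} {P : E → E}
    (hP : ∀ f, P f ∈ C ∧ ∀ v ∈ C, ‖f - P f‖ ≤ ‖f - v‖)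
    (j : V →L[ℂ] E) (hj : DenseRange j) (a : V →ₗ[ℂ] V →ₗ⋆[ℂ] ℂ)
    (ha : IsContinuousForm a) (hell : IsEllipticForm j a) {ω : ℝ}
    (hω : ∀ u, 0 ≤ (a u u).re + ω * ‖j u‖ ^ 2) (S : C0Semigroup E)
    (hS : ∀ x y, (x, y) ∈ S.generator.graph ↔ (x, -y) ∈ formGraph j a)
    (hcond : ∀ u, ∃ z, j z = P (j u) ∧ 0 ≤ (a z (u - z)).re) (x : E) (t : ℝ≥0) :
    ‖S.op t x - P (S.op t x)‖ ^ 2 ≤ ‖x - P x‖ ^ 2 * Real.exp (2 * ω * t) := by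
  have hdc := continuous_norm_sub_nearest hP
  revert x
  have hd := dense_formOperator_domain j hj a ha hell
  suffices H : ∀ x ∈ {x : E | ∃ y, (x, y) ∈ formGraph j a},
      ‖S.op t x - P (S.op t x)‖ ^ 2 ≤ ‖x - P x‖ ^ 2 * Real.exp (2 * ω * t) by
    have hcl : IsClosed {x | ‖S.op t x - P (S.op t x)‖ ^ 2 ≤
        ‖x - P x‖ ^ 2 * Real.exp (2 * ω * t)} :=
      isClosed_le ((hdc.comp (S.op t).continuous).pow 2) ((hdc.pow 2).mul_const _)
    intro x
    exact hcl.closure_subset_iff.2 H (hd x)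
  rintro x ⟨f, hf⟩
  have hxg : (x, -f) ∈ S.generator.graph := (hS _ _).2 (by rwa [neg_neg])
  let _ : InnerProductSpace ℝ E := InnerProductSpace.rclikeToReal ℂ E
  set γ : ℝ → E := fun s => S.op s.toNNReal x
  set γ' : ℝ → E := fun s => S.op s.toNNReal (-f)
  have hγc : Continuous γ := (S.continuous_orbit x).comp (by fun_prop)
  have main := le_gronwallBound_of_liminf_deriv_right_le
    (f := fun s => ‖γ s - P (γ s)‖ ^ 2)
    (f' := fun s => 2 * (inner ℂ (γ s - P (γ s)) (γ' s)).re)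
    (δ := ‖x - P x‖ ^ 2) (K := 2 * ω) (ε := 0) (a := 0) (b := t)
    ((hdc.comp hγc).pow 2).continuousOn ?_ (by simp [γ, S.op_zero]) ?_ t ⟨t.2, le_rfl⟩
  · simpa [γ, gronwallBound_ε0] using main
  · intro s hs r hr
    -- The squared distance to the frozen point `P (γ s)` dominates the squared distance to `C`,
    -- with equality at time `s`, so its right derivative bounds the upper Dini derivative. No
    -- differentiability of `P` is needed.
    have hder : HasDerivWithinAt (fun q => ‖γ q - P (γ s)‖ ^ 2)
        (2 * (inner ℂ (γ s - P (γ s)) (γ' s)).re) (Set.Ici s) s :=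
      ((S.hasDerivWithinAt_orbit hxg hs.1).sub_const (P (γ s))).norm_sq
    rw [hasDerivWithinAt_iff_tendsto_slope, Set.Ici_sdiff_left] at hder
    refine Eventually.frequently ?_
    filter_upwards [hder.eventually (gt_mem_nhds hr), self_mem_nhdsWithin] with z hz hz'
    have hz'' : s < z := hz'
    refine lt_of_le_of_lt ?_ hz
    rw [slope_def_module, smul_eq_mul]
    have h2 : ‖γ z - P (γ z)‖ ≤ ‖γ z - P (γ s)‖ := (hP (γ z)).2 _ (hP (γ s)).1
    have h3 : 0 ≤ (z - s)⁻¹ := inv_nonneg.2 (by linarith)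
    gcongr
  · intro s hs
    have h1 := (hS _ _).1 (S.mem_graph_generator_op hxg s.toNNReal)
    obtain ⟨u, hu, hu'⟩ := h1
    obtain ⟨z, hz, hz'⟩ := hcond u
    change j u = γ s at hu
    have h2 : a u (u - z) = inner ℂ (j (u - z)) (-γ' s) := hu' (u - z)
    have h3 : j (u - z) = γ s - P (γ s) := by rw [map_sub, hz, hu]
    rw [h3, inner_neg_right] at h2
    have h4 := hω (u - z)
    rw [h3] at h4
    -- The first summand is nonnegative by `hcond`, the second at least `-ω ‖γ s - P (γ s)‖²`.
    have h5 : (a u (u - z)).re = (a z (u - z)).re + (a (u - z) (u - z)).re := by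
      rw [← Complex.add_re, ← LinearMap.add_apply, ← map_add, add_sub_cancel]
    have h6 := congrArg Complex.re h2
    rw [Complex.neg_re] at h6
    change 2 * (inner ℂ (γ s - P (γ s)) (γ' s)).re ≤ 2 * ω * ‖γ s - P (γ s)‖ ^ 2 + 0
    linarith

/-- This is the distance estimate for `C = {0}`, where the condition on the form is trivial. -/
theorem norm_orbit_le (j : V →L[ℂ] E) (hj : DenseRange j) (a : V →ₗ[ℂ] V →ₗ⋆[ℂ] ℂ)
    (ha : IsContinuousForm a) (hell : IsEllipticForm j a) {ω : ℝ}
    (hω : ∀ u, 0 ≤ (a u u).re + ω * ‖j u‖ ^ 2) (S : C0Semigroup E)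
    (hS : ∀ x y, (x, y) ∈ S.generator.graph ↔ (x, -y) ∈ formGraph j a) (x : E) (t : ℝ≥0) :
    ‖S.op t x‖ ≤ Real.exp (ω * t) * ‖x‖ := by
  have := norm_sub_nearest_orbit_le (C := {0}) (P := fun _ => 0) (by simp) j hj a ha hell hω S hS
    (fun u => ⟨0, by simp⟩) x t
  refine (sq_le_sq₀ (norm_nonneg _) (by positivity)).1 ?_
  rw [mul_pow, ← Real.exp_nat_mul]
  simp only [sub_zero] at this
  refine this.trans_eq ?_
  rw [mul_comm]
  congr 2
  push_cast; ring

/-- Ouhabaz' criterion: a semigroup generated by an elliptic form leaves a closed convex set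
invariant if and only if the projection `P` onto this set leaves the form domain invariant and
`Re a(P u, u - P u) ≥ 0` for all `u` in the form domain. -/
theorem invariant_iff {C : Set E} {P : E → E} (hC : Convex ℝ C)
    (hP : ∀ f, P f ∈ C ∧ ∀ v ∈ C, ‖f - P f‖ ≤ ‖f - v‖)
    (j : V →L[ℂ] E) (hj : DenseRange j) (a : V →ₗ[ℂ] V →ₗ⋆[ℂ] ℂ)
    (ha : IsContinuousForm a) (hell : IsEllipticForm j a) (S : C0Semigroup E)
    (hS : ∀ x y, (x, y) ∈ S.generator.graph ↔ (x, -y) ∈ formGraph j a) :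
    (∀ x ∈ C, ∀ t : ℝ≥0, 0 < t → S.op t x ∈ C) ↔
      ∀ u, ∃ z, j z = P (j u) ∧ 0 ≤ (a z (u - z)).re := by
  obtain ⟨η, ω', hη, hell'⟩ := id hell
  set ω := max ω' 0
  have hω0 : 0 ≤ ω := le_max_right _ _
  have hel : ∀ u, η * ‖u‖ ^ 2 ≤ (a u u).re + ω * ‖j u‖ ^ 2 := fun u =>
    (hell' u).trans (add_le_add le_rfl
      (mul_le_mul_of_nonneg_right (le_max_left _ _) (sq_nonneg _)))
  have hω : ∀ u, 0 ≤ (a u u).re + ω * ‖j u‖ ^ 2 := fun u =>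
    (by positivity : 0 ≤ η * ‖u‖ ^ 2).trans (hel u)
  constructor
  · intro hinv u
    set z := P (j u)
    have hz : z ∈ C := (hP _).1
    obtain ⟨M, hM, hMa⟩ := id ha
    -- Here `w = l (l + A)⁻¹ z` with `l = 2ω + n + 1`. In `hest` the part `2ω` absorbs the term `ω
    -- ‖j (w n)‖²` from ellipticity; the remaining `n + 1` forces `j (w n) → z`.
    have hres : ∀ n : ℕ, ∃ w : V, ∀ v, a w v =
        ((2 * ω + n + 1 : ℝ) : ℂ) * inner ℂ (j v) (z - j w) := fun n => by
      obtain ⟨w, hw⟩ := exists_resolvent j a ha hη (l := 2 * ω + n + 1)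
        (fun u => (hel u).trans (by gcongr; linarith [n.cast_nonneg (α := ℝ)]))
        (((2 * ω + n + 1 : ℝ) : ℂ) • z)
      refine ⟨w, fun v => ?_⟩
      have := hw v
      rw [inner_smul_right] at this
      rw [inner_sub_right, mul_sub, ← this, add_sub_cancel_right]
    choose w hw using hres
    have hlpos : ∀ n : ℕ, 0 < 2 * ω + n + 1 := fun n => by positivity
    have hwC : ∀ n, j (w n) ∈ C := fun n => by
      refine resolvent_mem_of_invariant hC hP S (norm_orbit_le j hj a ha hell hω S hS) hinv
        (l := 2 * ω + n + 1) ?_ (hlpos n).le hz ((hS _ _).2 ⟨w n, rfl, fun v => ?_⟩)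
      · linarith [n.cast_nonneg (α := ℝ)]
      · rw [hw, ← smul_neg, neg_sub, inner_smul_right]
    have hvar : ∀ n, (inner ℂ (j u - z) (j (w n) - z)).re ≤ 0 := fun n =>
      re_inner_le_zero_of_nearest hC (hP _).1 (hP _).2 (hwC n)
    -- Test the equation for `w n` with `w n - u` and drop the term whose sign is known from `hvar`.
    have hwu : ∀ n, (a (w n) (w n)).re + (2 * ω + n + 1) * ‖z - j (w n)‖ ^ 2 ≤
        (a (w n) u).re := fun n => by
      have e : (a (w n) (w n)).re - (a (w n) u).re = (2 * ω + n + 1) *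
          ((inner ℂ (j u - z) (j (w n) - z)).re - ‖z - j (w n)‖ ^ 2) := by
        have e1 : (inner ℂ (z - j (w n)) (z - j (w n))).re = ‖z - j (w n)‖ ^ 2 :=
          inner_self_eq_norm_sq (𝕜 := ℂ) _
        rw [hw, hw, Complex.re_ofReal_mul, Complex.re_ofReal_mul, ← mul_sub, ← e1,
          ← Complex.sub_re, ← Complex.sub_re, ← inner_sub_left]
        congr 2
        rw [← neg_sub z (j (w n)), inner_neg_right, ← inner_neg_left, ← inner_sub_left]
        congr 1
        abel
      nlinarith [mul_nonneg (hlpos n).le (neg_nonneg.2 (hvar n))]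
    set R : ℝ := M ^ 2 * ‖u‖ ^ 2 / (2 * η) + 2 * ω * ‖z‖ ^ 2
    have hest : ∀ n, η / 2 * ‖w n‖ ^ 2 + (n + 1) * ‖z - j (w n)‖ ^ 2 ≤ R := fun n => by
      have h1 := hel (w n)
      have h2 := hwu n
      have h3 : (a (w n) u).re ≤ M * ‖w n‖ * ‖u‖ :=
        (Complex.re_le_norm _).trans (hMa _ _)
      have h4 : M * ‖w n‖ * ‖u‖ ≤ η / 2 * ‖w n‖ ^ 2 + M ^ 2 * ‖u‖ ^ 2 / (2 * η) := by
        have : η / 2 * ‖w n‖ ^ 2 + M ^ 2 * ‖u‖ ^ 2 / (2 * η) - M * ‖w n‖ * ‖u‖ =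
            (η * ‖w n‖ - M * ‖u‖) ^ 2 / (2 * η) := by field_simp; ring
        have h' : 0 ≤ (η * ‖w n‖ - M * ‖u‖) ^ 2 / (2 * η) := by positivity
        linarith
      have h5 : ‖j (w n)‖ ^ 2 ≤ 2 * ‖z‖ ^ 2 + 2 * ‖z - j (w n)‖ ^ 2 := by
        have : ‖j (w n)‖ ≤ ‖z‖ + ‖z - j (w n)‖ := by
          have := norm_sub_le z (z - j (w n))
          rwa [sub_sub_cancel] at this
        nlinarith [norm_nonneg (j (w n)), sq_nonneg (‖z‖ - ‖z - j (w n)‖)]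
      have h6 := mul_le_mul_of_nonneg_left h5 hω0
      simp only [R]
      linarith
    have hbdd : ∀ n, ‖w n‖ ≤ Real.sqrt (2 * R / η) := fun n => by
      refine Real.le_sqrt_of_sq_le ?_
      rw [le_div_iff₀ hη]
      have : 0 ≤ ((n : ℝ) + 1) * ‖z - j (w n)‖ ^ 2 := by positivity
      linarith [hest n]
    have hconv : Tendsto (fun n => j (w n)) atTop (𝓝 z) := by
      rw [tendsto_iff_norm_sub_tendsto_zero]
      have h1 : Tendsto (fun n : ℕ => Real.sqrt (R * (1 / ((n : ℝ) + 1)))) atTop (𝓝 0) := by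
        have := (tendsto_one_div_add_atTop_nhds_zero_nat (𝕜 := ℝ)).const_mul R
        rw [mul_zero] at this
        simpa using this.sqrt
      refine squeeze_zero (fun _ => norm_nonneg _) (fun n => Real.le_sqrt_of_sq_le ?_) h1
      rw [norm_sub_rev, mul_one_div, le_div_iff₀ (by positivity)]
      have : 0 ≤ η / 2 * ‖w n‖ ^ 2 := by positivity
      linarith [hest n]
    obtain ⟨y, G, hG, -, hy, hlim⟩ := exists_weak_limit j (.of_forall hbdd) hconv
    refine ⟨y, hy, ?_⟩
    -- With the second argument fixed at `u - y` the form is a bounded functional, so weak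
    -- convergence suffices; along the sequence its real part is nonnegative by `hvar`.
    let φ : V →L[ℂ] ℂ := (a.flip (u - y)).mkContinuous (M * ‖u - y‖) fun v => by
      rw [mul_right_comm]; exact hMa _ _
    refine ge_of_tendsto ((Complex.continuous_re.tendsto _).comp (hlim φ)) (.of_forall fun n => ?_)
    change 0 ≤ (a (w n) (u - y)).re
    rw [hw, Complex.re_ofReal_mul, map_sub, hy]
    refine mul_nonneg (hlpos n).le ?_
    have := hvar n
    rw [← neg_sub z (j (w n)), inner_neg_right, Complex.neg_re] at this
    linarith
  · intro hcond x hx t _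
    have h := norm_sub_nearest_orbit_le hP j hj a ha hell hω S hS hcond x t
    have hx0 : ‖x - P x‖ = 0 := le_antisymm (by simpa using (hP x).2 x hx) (norm_nonneg _)
    rw [hx0] at h
    have h0 : S.op t x = P (S.op t x) := sub_eq_zero.1 (by simpa using h)
    rw [h0]
    exact (hP _).1

end Invariance

/-! ### The projection onto the `L_p` unit ball -/

section PowSgn

variable {H : Type*} [NormedAddCommGroup H] [InnerProductSpace ℂ H] {p : ℝ}

/-- The function `x ↦ ‖x‖^(p-1) sgn x`. -/
def powSgn (p : ℝ) (x : H) : H := ((‖x‖ ^ (p - 1) : ℝ) : ℂ) • sgn x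

theorem powSgn_eq (x : H) : powSgn p x = ((‖x‖ ^ (p - 1) * ‖x‖⁻¹ : ℝ) : ℂ) • x := by
  rw [powSgn, sgn, smul_smul, Complex.ofReal_mul]

theorem norm_powSgn (hp : 1 < p) (x : H) : ‖powSgn p x‖ = ‖x‖ ^ (p - 1) := by
  rw [powSgn_eq, norm_smul, Complex.norm_real, Real.norm_of_nonneg (by positivity)]
  rcases eq_or_ne x 0 with rfl | hx
  · simp [Real.zero_rpow (by linarith : p - 1 ≠ 0)]
  · rw [mul_assoc, inv_mul_cancel₀ (norm_ne_zero_iff.2 hx), mul_one]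

theorem norm_rpow_sub_one_mul {H : Type*} [NormedAddCommGroup H] (hp : 1 < p) (x : H) :
    ‖x‖ ^ (p - 1) * ‖x‖ = ‖x‖ ^ p := by
  have := Real.rpow_add_of_nonneg (norm_nonneg x) (by linarith : 0 ≤ p - 1) zero_le_one
  rw [Real.rpow_one, sub_add_cancel] at this
  exact this.symm

theorem inner_powSgn_self (hp : 1 < p) (x : H) : inner ℂ (powSgn p x) x = (‖x‖ ^ p : ℝ) := by
  rw [powSgn_eq, inner_smul_left, inner_self_eq_norm_sq_to_K, Complex.conj_ofReal,
    ← norm_rpow_sub_one_mul hp]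
  rcases eq_or_ne x 0 with rfl | hx
  · simp
  · have : ‖x‖ ≠ 0 := norm_ne_zero_iff.2 hx
    push_cast
    have : (‖x‖ : ℂ) ≠ 0 := by exact_mod_cast this
    change _ * (‖x‖ : ℂ) ^ 2 = _
    field_simp

theorem powSgn_smul {c : ℝ} (hc : 0 < c) (x : H) :
    powSgn p ((c : ℂ) • x) = ((c ^ (p - 1) : ℝ) : ℂ) • powSgn p x := by
  rw [powSgn_eq, powSgn_eq, smul_smul, smul_smul, norm_smul, Complex.norm_real,
    Real.norm_of_nonneg hc.le, Real.mul_rpow hc.le (norm_nonneg x), mul_inv]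
  rw [← Complex.ofReal_mul, ← Complex.ofReal_mul]
  congr 2
  field_simp

/-- The subgradient inequality for the convex function `‖x‖^p / p`, from Cauchy–Schwarz and Young.
-/
theorem re_inner_powSgn_sub_le (hp : 1 < p) (x y : H) :
    (inner ℂ (powSgn p x) (y - x)).re ≤ (‖y‖ ^ p - ‖x‖ ^ p) / p := by
  have h1 : (inner ℂ (powSgn p x) y).re ≤ ‖x‖ ^ (p - 1) * ‖y‖ := by
    rw [← norm_powSgn hp x]
    exact re_inner_le_norm (𝕜 := ℂ) _ _
  have h2 := Real.young_inequality_of_nonneg (norm_nonneg y)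
    (Real.rpow_nonneg (norm_nonneg x) (p - 1)) (Real.HolderConjugate.conjExponent hp)
  have h3 : (‖x‖ ^ (p - 1)) ^ p.conjExponent = ‖x‖ ^ p := by
    rw [← Real.rpow_mul (norm_nonneg x), Real.conjExponent, mul_div_cancel₀]
    linarith
  rw [h3, Real.conjExponent] at h2
  rw [inner_sub_right, inner_powSgn_self hp, Complex.sub_re, Complex.ofReal_re]
  have h4 : ‖y‖ ^ p / p + ‖x‖ ^ p / (p / (p - 1)) - ‖x‖ ^ p = (‖y‖ ^ p - ‖x‖ ^ p) / p := by
    have : p ≠ 0 := by linarith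
    have : p - 1 ≠ 0 := by linarith
    field_simp
    ring
  linarith

theorem norm_scale (r : ℝ) (hr : 0 ≤ r) {y : H} (h : r ≤ ‖y‖) :
    ‖((r / ‖y‖ : ℝ) : ℂ) • y‖ = r := by
  rw [norm_smul, Complex.norm_real, Real.norm_of_nonneg (by positivity)]
  rcases eq_or_ne y 0 with rfl | hy
  · simp only [norm_zero, mul_zero] at h ⊢
    exact le_antisymm hr h
  · exact div_mul_cancel₀ _ (norm_ne_zero_iff.2 hy)

/-- A radial ansatz reduces the vector equation `x + c ‖x‖^(p-1) sgn x = y` to a scalar equation for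
`r = ‖x‖`. -/
theorem scale_add_powSgn (hp : 1 < p) {c r : ℝ} (hc : 0 ≤ c) (hr : 0 ≤ r) {y : H}
    (h : r + c * r ^ (p - 1) = ‖y‖) :
    ((r / ‖y‖ : ℝ) : ℂ) • y + (c : ℂ) • powSgn p (((r / ‖y‖ : ℝ) : ℂ) • y) = y := by
  have hle : r ≤ ‖y‖ := by
    have : 0 ≤ c * r ^ (p - 1) := by positivity
    linarith
  rw [powSgn_eq, norm_scale r hr hle, smul_smul, smul_smul, ← add_smul]
  rcases eq_or_ne y 0 with rfl | hy
  · simp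
  have hy' : ‖y‖ ≠ 0 := norm_ne_zero_iff.2 hy
  have hr' : r ≠ 0 := by
    rintro rfl
    rw [Real.zero_rpow (by linarith), mul_zero, add_zero] at h
    exact hy' h.symm
  have : r / ‖y‖ + c * (r ^ (p - 1) * r⁻¹) * (r / ‖y‖) = 1 := by
    field_simp
    exact h
  norm_cast
  rw [this, one_smul]

/-- The solution `ρ c s` of the equation `r + c r^(p-1) = s`. -/
theorem exists_shrink (hp : 1 < p) : ∃ ρ : ℝ → ℝ → ℝ,
    (∀ c s, 0 ≤ c → 0 ≤ s → 0 ≤ ρ c s ∧ ρ c s + c * ρ c s ^ (p - 1) = s) ∧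
    ∀ c, 0 ≤ c → Measurable (ρ c) := by
  -- Replacing `s` by `max s 0` makes the solution monotone on all of `ℝ`, hence measurable.
  have key : ∀ c s : ℝ, 0 ≤ c → ∃ r : ℝ, 0 ≤ r ∧ r + c * r ^ (p - 1) = max s 0 := by
    intro c s hc
    have hs : 0 ≤ max s 0 := le_max_right _ _
    have hcont : ContinuousOn (fun r : ℝ => r + c * r ^ (p - 1)) (Set.Icc 0 (max s 0)) :=
      (continuous_id.add (continuous_const.mul
        (Real.continuous_rpow_const (by linarith)))).continuousOn
    have hmem : max s 0 ∈ Set.Icc (0 + c * 0 ^ (p - 1)) (max s 0 + c * max s 0 ^ (p - 1)) := by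
      refine ⟨?_, le_add_of_nonneg_right (by positivity)⟩
      rwa [Real.zero_rpow (by linarith), mul_zero, add_zero]
    obtain ⟨r, hr, hr'⟩ := intermediate_value_Icc hs hcont hmem
    exact ⟨r, hr.1, hr'⟩
  choose! ρ hρ using key
  refine ⟨ρ, fun c s hc hs => ?_, fun c hc => Monotone.measurable fun s s' hss => ?_⟩
  · simpa [max_eq_left hs] using hρ c s hc
  · by_contra! hlt
    have h1 := (hρ c s hc).2
    have h2 := (hρ c s' hc).2
    have h3 : ρ c s' ^ (p - 1) ≤ ρ c s ^ (p - 1) :=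
      Real.rpow_le_rpow (hρ c s' hc).1 hlt.le (by linarith)
    have h4 := mul_le_mul_of_nonneg_left h3 hc
    have h5 : max s 0 ≤ max s' 0 := max_le_max hss le_rfl
    linarith

/-- The solution decreases in `c`. Subtracting the equations for `c ≤ d` gives `ρ c - ρ d ≤ (d - c)
(ρ d)^(p-1)`, a Lipschitz bound with constant `s^(p-1)`. -/
theorem shrink_continuousOn (hp : 1 < p) {s : ℝ} (hs : 0 ≤ s) {ρ : ℝ → ℝ}
    (hρ : ∀ c, 0 ≤ c → 0 ≤ ρ c ∧ ρ c + c * ρ c ^ (p - 1) = s) :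
    ContinuousOn ρ (Set.Ici 0) := by
  have key : ∀ c d, 0 ≤ c → c ≤ d → |ρ c - ρ d| ≤ s ^ (p - 1) * |c - d| := by
    intro c d hc hcd
    obtain ⟨h1, h2⟩ := hρ c hc
    obtain ⟨h3, h4⟩ := hρ d (hc.trans hcd)
    have hle : ρ d ≤ ρ c := by
      by_contra! hlt
      have : ρ c ^ (p - 1) ≤ ρ d ^ (p - 1) := Real.rpow_le_rpow h1 hlt.le (by linarith)
      have := mul_le_mul hcd this (by positivity) (by linarith)
      linarith
    have h5 : ρ d ^ (p - 1) ≤ ρ c ^ (p - 1) := Real.rpow_le_rpow h3 hle (by linarith)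
    have h6 : ρ d ^ (p - 1) ≤ s ^ (p - 1) := by
      refine Real.rpow_le_rpow h3 ?_ (by linarith)
      have : 0 ≤ d * ρ d ^ (p - 1) := mul_nonneg (hc.trans hcd) (by positivity)
      linarith
    rw [abs_of_nonneg (sub_nonneg.2 hle), abs_sub_comm, abs_of_nonneg (sub_nonneg.2 hcd)]
    nlinarith [mul_le_mul_of_nonneg_left h5 hc,
      mul_le_mul_of_nonneg_left h6 (sub_nonneg.2 hcd)]
  refine (LipschitzOnWith.of_dist_le_mul (K := (s ^ (p - 1)).toNNReal)
    fun c hc d hd => ?_).continuousOn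
  rw [Real.coe_toNNReal _ (by positivity), Real.dist_eq, Real.dist_eq]
  rcases le_total c d with h | h
  · exact key c d hc h
  · rw [abs_sub_comm, abs_sub_comm c]
    exact key d c hd h

end PowSgn

/-! ### Lagrange multipliers and the Euler–Lagrange equation for the projection -/

section Projection

variable {Ω : Type*} [MeasurableSpace Ω] {μ : Measure Ω}
  {H : Type*} [NormedAddCommGroup H] {p : ℝ}

theorem integrable_norm_rpow_iff_memLp (hp : 1 < p) {f : Ω → H} (hf : AEStronglyMeasurable f μ) :
    Integrable (fun x => ‖f x‖ ^ p) μ ↔ MemLp f (ENNReal.ofReal p) μ := by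
  have := integrable_norm_rpow_iff (p := ENNReal.ofReal p) hf
    (by simpa using by linarith) ENNReal.ofReal_ne_top
  rwa [ENNReal.toReal_ofReal (by linarith)] at this

theorem eLpNorm_eq_ofReal (hp : 1 < p) {f : Ω → H} (hf : MemLp f (ENNReal.ofReal p) μ) :
    eLpNorm f (ENNReal.ofReal p) μ = ENNReal.ofReal ((∫ x, ‖f x‖ ^ p ∂μ) ^ p⁻¹) := by
  rw [hf.eLpNorm_eq_integral_rpow_norm (by simpa using by linarith) ENNReal.ofReal_ne_top,
    ENNReal.toReal_ofReal (by linarith)]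

theorem eLpNorm_le_one_iff (hp : 1 < p) {f : Ω → H} (hf : MemLp f (ENNReal.ofReal p) μ) :
    eLpNorm f (ENNReal.ofReal p) μ ≤ 1 ↔ ∫ x, ‖f x‖ ^ p ∂μ ≤ 1 := by
  have h0 : 0 ≤ ∫ x, ‖f x‖ ^ p ∂μ := integral_nonneg fun x => by positivity
  rw [eLpNorm_eq_ofReal hp hf, ENNReal.ofReal_le_one]
  refine ⟨fun h => ?_, fun h => Real.rpow_le_one h0 h (by positivity)⟩
  by_contra! hlt
  exact absurd h (Real.one_lt_rpow hlt (by positivity)).not_ge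

theorem mem_lpBall_iff (hp : 1 < p) [InnerProductSpace ℂ H] {u : Lp H 2 μ} :
    u ∈ lpBall μ H p ↔ MemLp u (ENNReal.ofReal p) μ ∧ ∫ x, ‖u x‖ ^ p ∂μ ≤ 1 :=
  and_congr_right fun h => eLpNorm_le_one_iff hp h

variable [InnerProductSpace ℂ H]

/-- Outside of the `L_p` unit ball, every `f` can be decomposed as `u + c |u|^(p-1) sgn u` with `u`
in the unit sphere of `L_p`. -/
theorem exists_eq_add_powSgn (hp : 1 < p) (f : Lp H 2 μ) (hf : f ∉ lpBall μ H p) :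
    ∃ c : ℝ, 0 < c ∧ ∃ u : Lp H 2 μ, u ∈ lpBall μ H p ∧ ∫ x, ‖u x‖ ^ p ∂μ = 1 ∧
      ∀ᵐ x ∂μ, u x + (c : ℂ) • powSgn p (u x) = f x := by
  obtain ⟨ρ, hρ, hρm⟩ := exists_shrink hp
  have hp0 : 0 < p := by linarith
  have hle : ∀ c s, 0 ≤ c → 0 ≤ s → ρ c s ≤ s := fun c s hc hs => by
    obtain ⟨h1, h2⟩ := hρ c s hc hs
    have : 0 ≤ c * ρ c s ^ (p - 1) := by positivity
    linarith
  -- Multiply `c ρ^(p-1) ≤ s` by `ρ ≤ s`. So for `c > 0` the shrunken function is in `L_p` although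
  -- `f` is only in `L_2`, with a majorant for dominated convergence.
  have hpow : ∀ c s, 0 < c → 0 ≤ s → ρ c s ^ p ≤ s ^ 2 / c := fun c s hc hs => by
    obtain ⟨h1, h2⟩ := hρ c s hc.le hs
    have h3 := hle c s hc.le hs
    have h4 := norm_rpow_sub_one_mul hp (ρ c s)
    rw [Real.norm_of_nonneg h1] at h4
    rw [le_div_iff₀ hc, ← h4]
    have h5 : c * ρ c s ^ (p - 1) ≤ s := by linarith
    have h6 := mul_le_mul h5 h3 h1 hs
    linarith
  let U : ℝ → Ω → H := fun c x => ((ρ c ‖f x‖ / ‖f x‖ : ℝ) : ℂ) • f x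
  have hfm : AEStronglyMeasurable f μ := Lp.aestronglyMeasurable f
  have hUm : ∀ c, 0 ≤ c → AEStronglyMeasurable (U c) μ := fun c hc => by
    have h1 : AEMeasurable (fun x => ρ c ‖f x‖ / ‖f x‖) μ :=
      ((hρm c hc).comp_aemeasurable hfm.norm.aemeasurable).div hfm.norm.aemeasurable
    exact (Complex.measurable_ofReal.comp_aemeasurable h1).aestronglyMeasurable.smul hfm
  have hUn : ∀ c, 0 ≤ c → ∀ x, ‖U c x‖ = ρ c ‖f x‖ := fun c hc x =>
    norm_scale _ (hρ c _ hc (norm_nonneg _)).1 (hle c _ hc (norm_nonneg _))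
  have hf2 : Integrable (fun x => ‖f x‖ ^ 2) μ := (Lp.memLp f).integrable_norm_pow two_ne_zero
  have hUint : ∀ c, 0 < c → Integrable (fun x => ‖U c x‖ ^ p) μ := fun c hc => by
    refine (hf2.div_const c).mono'
      ((hUm c hc.le).norm.aemeasurable.pow_const p).aestronglyMeasurable (.of_forall fun x => ?_)
    rw [Real.norm_of_nonneg (by positivity), hUn c hc.le]
    exact hpow c _ hc (norm_nonneg _)
  have hUp : ∀ c, 0 < c → MemLp (U c) (ENNReal.ofReal p) μ := fun c hc =>
    (integrable_norm_rpow_iff_memLp hp (hUm c hc.le)).1 (hUint c hc)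
  have hU2 : ∀ c, 0 < c → MemLp (U c) 2 μ := fun c hc =>
    (Lp.memLp f).of_le (hUm c hc.le) (.of_forall fun x => by
      rw [hUn c hc.le]; exact hle c _ hc.le (norm_nonneg _))
  let G : ℝ → ℝ := fun c => ∫ x, ‖U c x‖ ^ p ∂μ
  have hρc : ∀ x, ContinuousOn (fun c => ρ c ‖f x‖) (Set.Ici 0) := fun x =>
    shrink_continuousOn hp (norm_nonneg (f x)) fun c hc => hρ c _ hc (norm_nonneg _)
  -- If `G c ≤ 1` for all `c > 0`, then `U c → f` pointwise as `c → 0` and Fatou would put `f` in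
  -- the ball.
  obtain ⟨c₀, hc₀, hGc₀⟩ : ∃ c, 0 < c ∧ 1 < G c := by
    by_contra! h
    refine hf ?_
    let c : ℕ → ℝ := fun n => 1 / ((n : ℝ) + 1)
    have hc : ∀ n, 0 < c n := fun n => by positivity
    have hclim : Tendsto c atTop (𝓝[Set.Ici 0] 0) :=
      tendsto_nhdsWithin_iff.2 ⟨tendsto_one_div_add_atTop_nhds_zero_nat,
        .of_forall fun n => (hc n).le⟩
    have key : eLpNorm f (ENNReal.ofReal p) μ ≤ 1 := by
      refine Lp.eLpNorm_le_of_ae_tendsto (u := atTop) (f := fun n => U (c n))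
        (.of_forall fun n => (eLpNorm_le_one_iff hp (hUp _ (hc n))).2 (h _ (hc n)))
        (fun n => hUm _ (hc n).le) (.of_forall fun x => ?_)
      have h0 : ρ 0 ‖f x‖ = ‖f x‖ := by simpa using (hρ 0 _ le_rfl (norm_nonneg (f x))).2
      have h1 : Tendsto (fun n => ρ (c n) ‖f x‖) atTop (𝓝 ‖f x‖) := by
        have := ((hρc x) 0 Set.self_mem_Ici).tendsto.comp hclim
        rwa [h0] at this
      rcases eq_or_ne (f x) 0 with h2 | h2
      · simp [U, h2]
      have h3 : Tendsto (fun n => ((ρ (c n) ‖f x‖ / ‖f x‖ : ℝ) : ℂ) • f x) atTop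
          (𝓝 (((‖f x‖ / ‖f x‖ : ℝ) : ℂ) • f x)) :=
        ((Complex.continuous_ofReal.tendsto _).comp (h1.div_const _)).smul_const _
      rwa [div_self (norm_ne_zero_iff.2 h2), Complex.ofReal_one, one_smul] at h3
    exact ⟨⟨hfm, key.trans_lt ENNReal.one_lt_top⟩, key⟩
  set I := ∫ x, ‖f x‖ ^ 2 ∂μ
  have hI : 0 ≤ I := integral_nonneg fun x => by positivity
  -- By `hpow`, `G c ≤ I / c`, so `c₀ + I` is large enough for the other end of the intermediate
  -- value argument.
  have hGc₁ : G (c₀ + I) ≤ 1 := by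
    calc G (c₀ + I) ≤ ∫ x, ‖f x‖ ^ 2 / (c₀ + I) ∂μ :=
          integral_mono (hUint _ (by positivity)) (hf2.div_const _) fun x => by
            simp only
            rw [hUn _ (by positivity)]
            exact hpow _ _ (by positivity) (norm_nonneg _)
      _ = I / (c₀ + I) := integral_div _ _
      _ ≤ 1 := by rw [div_le_one (by positivity)]; linarith
  have hGcont : ContinuousOn G (Set.Icc c₀ (c₀ + I)) := by
    refine continuousOn_of_dominated (bound := fun x => ‖f x‖ ^ 2 / c₀)
      (fun c hc => (hUint c (hc₀.trans_le hc.1)).aestronglyMeasurable)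
      (fun c hc => .of_forall fun x => ?_) (hf2.div_const _) (.of_forall fun x => ?_)
    · have hc' := hc₀.trans_le hc.1
      rw [Real.norm_of_nonneg (by positivity), hUn c hc'.le]
      refine (hpow c _ hc' (norm_nonneg _)).trans ?_
      gcongr
      exact hc.1
    · have h1 : ContinuousOn (fun c => ρ c ‖f x‖ ^ p) (Set.Icc c₀ (c₀ + I)) :=
        ((hρc x).mono fun c hc => hc₀.le.trans hc.1).rpow_const fun _ _ => Or.inr hp0.le
      exact h1.congr fun c hc => by simp only; rw [hUn c (hc₀.le.trans hc.1)]
  obtain ⟨c, hc, hGc⟩ := intermediate_value_Icc' (by linarith) hGcont ⟨hGc₁, hGc₀.le⟩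
  have hc0 : 0 < c := hc₀.trans_le hc.1
  have hco := (hU2 c hc0).coeFn_toLp
  have hint : ∫ x, ‖(hU2 c hc0).toLp (U c) x‖ ^ p ∂μ = 1 := by
    rw [← hGc]
    refine integral_congr_ae ?_
    filter_upwards [hco] with x hx
    rw [hx]
  refine ⟨c, hc0, (hU2 c hc0).toLp (U c), (mem_lpBall_iff hp).2
    ⟨(memLp_congr_ae hco).2 (hUp c hc0), hint.le⟩, hint, ?_⟩
  filter_upwards [hco] with x hx
  rw [hx]
  exact scale_add_powSgn hp hc0.le (hρ c _ hc0.le (norm_nonneg _)).1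
    (hρ c _ hc0.le (norm_nonneg _)).2

theorem lpBallProj_eq_of_re_inner_le [CompleteSpace H] (hp : 1 < p) {f u : Lp H 2 μ}
    (hu : u ∈ lpBall μ H p) (h : ∀ v ∈ lpBall μ H p, (inner ℂ (f - u) (v - u)).re ≤ 0) :
    lpBallProj μ H hp f = u :=
  (existsUnique_nearest μ H hp f).unique (lpBallProj_spec μ H hp f)
    ⟨hu, fun v hv => norm_sub_le_of_re_inner_le_zero (h v hv)⟩

theorem lpBallProj_of_mem [CompleteSpace H] (hp : 1 < p) {f : Lp H 2 μ} (hf : f ∈ lpBall μ H p) :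
    lpBallProj μ H hp f = f :=
  lpBallProj_eq_of_re_inner_le hp hf fun v _ => by simp

/-- Integrating the subgradient inequality gives `Re(f - u, v - u) ≤ c (∫ ‖v‖^p - 1) / p ≤ 0` for
`v` in the ball, the variational inequality that characterizes the projection. -/
theorem lpBallProj_eq [CompleteSpace H] (hp : 1 < p) {f u : Lp H 2 μ} {c : ℝ} (hc : 0 ≤ c)
    (hu : u ∈ lpBall μ H p) (hint : ∫ x, ‖u x‖ ^ p ∂μ = 1)
    (h : ∀ᵐ x ∂μ, (f - u) x = (c : ℂ) • powSgn p (u x)) :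
    lpBallProj μ H hp f = u := by
  refine lpBallProj_eq_of_re_inner_le hp hu fun v hv => ?_
  have hup := ((integrable_norm_rpow_iff_memLp hp hu.1.1).2 hu.1)
  have hvp := ((integrable_norm_rpow_iff_memLp hp hv.1.1).2 hv.1)
  have hv1 := ((mem_lpBall_iff hp).1 hv).2
  have hre : (inner ℂ (f - u) (v - u)).re = ∫ x, (inner ℂ ((f - u) x) ((v - u) x)).re ∂μ := by
    rw [L2.inner_def]
    exact (integral_re (L2.integrable_inner (𝕜 := ℂ) (f - u) (v - u))).symm
  rw [hre]
  calc ∫ x, (inner ℂ ((f - u) x) ((v - u) x)).re ∂μ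
      ≤ ∫ x, c * ((‖v x‖ ^ p - ‖u x‖ ^ p) / p) ∂μ := by
        refine integral_mono_ae (L2.integrable_inner (𝕜 := ℂ) (f - u) (v - u)).re
          (((hvp.sub hup).div_const p).const_mul c) ?_
        filter_upwards [h, Lp.coeFn_sub v u] with x hx hx'
        rw [hx, hx', inner_smul_left, Complex.conj_ofReal, Complex.re_ofReal_mul]
        exact mul_le_mul_of_nonneg_left (re_inner_powSgn_sub_le hp _ _) hc
    _ = c * ((∫ x, ‖v x‖ ^ p ∂μ - 1) / p) := by
        rw [integral_const_mul, integral_div, integral_sub hvp hup, hint]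
    _ ≤ 0 := mul_nonpos_of_nonneg_of_nonpos hc
        (div_nonpos_of_nonpos_of_nonneg (by linarith) (by linarith))

/-- The Euler–Lagrange equation for the projection onto the `L_p` unit ball. -/
theorem sub_lpBallProj [CompleteSpace H] (hp : 1 < p) {f : Lp H 2 μ} (hf : f ∉ lpBall μ H p) :
    ∃ c : ℝ, 0 < c ∧
      ∀ᵐ x ∂μ, (f - lpBallProj μ H hp f) x = (c : ℂ) • powSgn p (lpBallProj μ H hp f x) := by
  obtain ⟨c, hc, u, hu, hint, h⟩ := exists_eq_add_powSgn hp f hf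
  have h' : ∀ᵐ x ∂μ, (f - u) x = (c : ℂ) • powSgn p (u x) := by
    filter_upwards [h, Lp.coeFn_sub f u] with x hx hx'
    rw [hx', Pi.sub_apply, ← hx, add_sub_cancel_left]
  rw [lpBallProj_eq hp hc.le hu hint h']
  exact ⟨c, hc, h'⟩

end Projection

/-! ### From `L_p` contractivity to the form inequality -/

section Contractivity

theorem mem_graph_iff_of_generator_eq {V E : Type*} [NormedAddCommGroup V] [InnerProductSpace ℂ V]
    [NormedAddCommGroup E] [InnerProductSpace ℂ E] (j : V →L[ℂ] E) (hinj : Function.Injective j)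
    (hd : DenseRange j) (a : V →ₗ[ℂ] V →ₗ⋆[ℂ] ℂ) {S : C0Semigroup E}
    (hS : S.generator = -formOperator j a) (x y : E) :
    (x, y) ∈ S.generator.graph ↔ (x, -y) ∈ formGraph j a := by
  rw [hS, ← graph_formOperator j hinj hd a, LinearPMap.mem_graph_iff, LinearPMap.mem_graph_iff]
  refine exists_congr fun z => and_congr_right fun _ => ?_
  rw [LinearPMap.neg_apply, neg_eq_iff_eq_neg]

variable {Ω : Type*} [MeasurableSpace Ω] {μ : Measure Ω}
  {H : Type*} [NormedAddCommGroup H] [InnerProductSpace ℂ H] {p : ℝ}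

/-- A bounded operator is an `L_p` contraction if and only if it leaves the `L_p` unit ball
invariant. -/
theorem contraction_iff_mapsTo_lpBall (hp : 1 < p) (T : Lp H 2 μ →L[ℂ] Lp H 2 μ) :
    (∀ u : Lp H 2 μ, MemLp u (ENNReal.ofReal p) μ →
      eLpNorm (T u) (ENNReal.ofReal p) μ ≤ eLpNorm u (ENNReal.ofReal p) μ) ↔
    ∀ u ∈ lpBall μ H p, T u ∈ lpBall μ H p := by
  constructor
  · intro h u hu
    have := (h u hu.1).trans hu.2
    exact ⟨⟨Lp.aestronglyMeasurable _, this.trans_lt ENNReal.one_lt_top⟩, this⟩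
  · intro h u hu
    have hp0 : ENNReal.ofReal p ≠ 0 := by simpa using by linarith
    set N := eLpNorm u (ENNReal.ofReal p) μ
    rcases eq_or_ne N 0 with h0 | h0
    · have hu0 : u = 0 := (Lp.eq_zero_iff_ae_eq_zero).2
        ((eLpNorm_eq_zero_iff (Lp.aestronglyMeasurable _) hp0).1 h0)
      rw [hu0, map_zero, eLpNorm_congr_ae (Lp.coeFn_zero H 2 μ)]
      simp
    have hN : N ≠ ⊤ := hu.2.ne
    have hNr : 0 < N.toReal := ENNReal.toReal_pos h0 hN
    set c : ℂ := ((N.toReal⁻¹ : ℝ) : ℂ)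
    have hce : ‖c‖ₑ = N⁻¹ := by
      rw [← ofReal_norm, Complex.norm_real, Real.norm_of_nonneg (by positivity),
        ENNReal.ofReal_inv_of_pos hNr, ENNReal.ofReal_toReal hN]
    have hsm : ∀ v : Lp H 2 μ, eLpNorm (c • v : Lp H 2 μ) (ENNReal.ofReal p) μ =
        N⁻¹ * eLpNorm v (ENNReal.ofReal p) μ := fun v => by
      rw [eLpNorm_congr_ae (Lp.coeFn_smul c v), eLpNorm_const_smul, hce]
    have hmem : c • u ∈ lpBall μ H p := by
      have : eLpNorm (c • u : Lp H 2 μ) (ENNReal.ofReal p) μ ≤ 1 := by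
        rw [hsm, ENNReal.inv_mul_cancel h0 hN]
      exact ⟨⟨Lp.aestronglyMeasurable _, this.trans_lt ENNReal.one_lt_top⟩, this⟩
    have h1 := (h _ hmem).2
    rw [map_smul, hsm] at h1
    have h2 := mul_le_mul_right h1 N
    rwa [← mul_assoc, ENNReal.mul_inv_cancel h0 hN, one_mul, mul_one] at h2

variable [CompleteSpace H] {V : Type*} [NormedAddCommGroup V] [InnerProductSpace ℂ V]

/-- For the `L_p` unit ball, the condition in Ouhabaz' criterion is a condition on the pairings of
`u` with `|u|^(p-1) sgn u`. -/
theorem exists_lpBallProj_iff (hp : 1 < p) (j : V →L[ℂ] Lp H 2 μ) (hinj : Function.Injective j)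
    (a : V →ₗ[ℂ] V →ₗ⋆[ℂ] ℂ) :
    (∀ u, ∃ z, j z = lpBallProj μ H hp (j u) ∧ 0 ≤ (a z (u - z)).re) ↔
      (∀ v : V, lpBallProj μ H hp (j v) ∈ Set.range j) ∧
        ∀ u w : V, (j w : Ω → H) =ᵐ[μ] (fun x => powSgn p (j u x)) → 0 ≤ (a u w).re := by
  constructor
  · refine fun h => ⟨fun v => (h v).imp fun z hz => hz.1, fun u w hw => ?_⟩
    -- That `u` lies in `L_p` is automatic: `‖u‖^p` is the pointwise inner product of the two `L_2`
    -- functions `j w` and `j u`.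
    have hint : Integrable (fun x => ‖j u x‖ ^ p) μ := by
      refine (L2.integrable_inner (𝕜 := ℂ) (j w) (j u)).re.congr ?_
      filter_upwards [hw] with x hx
      rw [hx, inner_powSgn_self hp]
      exact Complex.ofReal_re _
    set N := ∫ x, ‖j u x‖ ^ p ∂μ
    have hN0 : 0 ≤ N := integral_nonneg fun x => by positivity
    rcases hN0.eq_or_lt with h0 | hN
    · have h1 : (fun x => ‖j u x‖ ^ p) =ᵐ[μ] 0 :=
        (integral_eq_zero_iff_of_nonneg (fun x => by positivity) hint).1 h0.symm
      have h2 : j u = 0 := by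
        refine (Lp.eq_zero_iff_ae_eq_zero).2 ?_
        filter_upwards [h1] with x hx
        exact norm_eq_zero.1 ((Real.rpow_eq_zero (norm_nonneg _) (by linarith)).1 hx)
      have h3 : u = 0 := hinj (by rw [h2, map_zero])
      simp [h3]
    -- The factor `c` normalizes `u` in `L_p`, and by homogeneity `d w`, with `d = c^(p-1)`, is the
    -- normal at `c u`. So `c u + d w` projects to `c u`, and the criterion there reads `c d Re a(u,
    -- w) ≥ 0`.
    set c : ℝ := N ^ (-p⁻¹)
    have hc : 0 < c := Real.rpow_pos_of_pos hN _
    have hcp : c ^ p * N = 1 := by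
      rw [← Real.rpow_mul hN.le, neg_mul, inv_mul_cancel₀ (by linarith), Real.rpow_neg_one,
        inv_mul_cancel₀ hN.ne']
    set d : ℝ := c ^ (p - 1)
    have hd : 0 < d := Real.rpow_pos_of_pos hc _
    have hsm := Lp.coeFn_smul (c : ℂ) (j u)
    have hint1 : ∫ x, ‖j ((c : ℂ) • u) x‖ ^ p ∂μ = 1 := by
      rw [map_smul, ← hcp, ← integral_const_mul]
      refine integral_congr_ae ?_
      filter_upwards [hsm] with x hx
      rw [hx, Pi.smul_apply, norm_smul, Complex.norm_real, Real.norm_of_nonneg hc.le,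
        Real.mul_rpow hc.le (norm_nonneg _)]
    have hmem : j ((c : ℂ) • u) ∈ lpBall μ H p := by
      refine (mem_lpBall_iff hp).2 ⟨?_, hint1.le⟩
      rw [map_smul, memLp_congr_ae hsm]
      exact ((integrable_norm_rpow_iff_memLp hp (Lp.aestronglyMeasurable _)).1 hint).const_smul _
    have hproj : lpBallProj μ H hp (j ((c : ℂ) • u + (d : ℂ) • w)) = j ((c : ℂ) • u) := by
      refine lpBallProj_eq hp zero_le_one hmem hint1 ?_
      rw [← map_sub, add_sub_cancel_left, map_smul, map_smul]
      filter_upwards [hsm, hw, Lp.coeFn_smul (d : ℂ) (j w)] with x h1 h2 h3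
      rw [h3, h1, Pi.smul_apply, Pi.smul_apply, h2, powSgn_smul hc, Complex.ofReal_one, one_smul]
    obtain ⟨z, hz, hz'⟩ := h ((c : ℂ) • u + (d : ℂ) • w)
    rw [hproj] at hz
    rw [hinj hz, add_sub_cancel_left] at hz'
    simp only [map_smul, LinearMap.smul_apply, LinearMap.map_smulₛₗ, Complex.conj_ofReal,
      smul_eq_mul, Complex.re_ofReal_mul] at hz'
    exact nonneg_of_mul_nonneg_right (by linarith) (mul_pos hc hd)
  · rintro ⟨h1, h2⟩ u
    obtain ⟨z, hz⟩ := h1 u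
    refine ⟨z, hz, ?_⟩
    by_cases hu : j u ∈ lpBall μ H p
    · rw [lpBallProj_of_mem hp hu] at hz
      simp [hinj hz]
    obtain ⟨c, hc, h⟩ := sub_lpBallProj hp hu
    rw [← hz, ← map_sub] at h
    -- By the Euler–Lagrange equation `c⁻¹ (u - z)` represents `‖z‖^(p-1) sgn z`, which therefore
    -- lies in the form domain.
    have h3 := h2 z (((c⁻¹ : ℝ) : ℂ) • (u - z)) (by
      rw [map_smul]
      filter_upwards [h, Lp.coeFn_smul ((c⁻¹ : ℝ) : ℂ) (j (u - z))] with x hx hx'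
      rw [hx', Pi.smul_apply, hx, smul_smul, ← Complex.ofReal_mul, inv_mul_cancel₀ hc.ne',
        Complex.ofReal_one, one_smul])
    rw [LinearMap.map_smulₛₗ, Complex.conj_ofReal, smul_eq_mul, Complex.re_ofReal_mul] at h3
    exact nonneg_of_mul_nonneg_right h3 (inv_pos.2 hc)

end Contractivity

end LpContractivity

end

theorem theorem1p1
    {Ω : Type*} [MeasurableSpace Ω] (μ : Measure Ω) [SigmaFinite μ]
    {H : Type*} [NormedAddCommGroup H] [InnerProductSpace ℂ H] [CompleteSpace H]
    (p : ℝ) (hp : 1 < p)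
    {V : Type*} [NormedAddCommGroup V] [InnerProductSpace ℂ V] [CompleteSpace V]
    (j : V →L[ℂ] Lp H 2 μ) (hj_inj : Function.Injective j) (hj_dense : DenseRange j)
    (a : V →ₗ[ℂ] V →ₗ⋆[ℂ] ℂ)
    (ha_cont : LpContractivity.IsContinuousForm a)
    (ha_ell : LpContractivity.IsEllipticForm j a)
    (S : LpContractivity.C0Semigroup (Lp H 2 μ))
    (hS : S.generator = -LpContractivity.formOperator j a) :
    (∀ u : Lp H 2 μ, MemLp u (ENNReal.ofReal p) μ → ∀ t : ℝ≥0, 0 < t →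
        eLpNorm (S.op t u) (ENNReal.ofReal p) μ ≤ eLpNorm u (ENNReal.ofReal p) μ) ↔
      ((∀ v : V, LpContractivity.lpBallProj μ H hp (j v) ∈ Set.range j) ∧
        ∀ u w : V,
          (j w : Ω → H) =ᵐ[μ]
            (fun x => ((‖j u x‖ ^ (p - 1) : ℝ) : ℂ) • LpContractivity.sgn (j u x)) →
          0 ≤ (a u w).re) := by
  refine Iff.trans ?_ ((LpContractivity.invariant_iff (LpContractivity.convex_lpBall μ H hp)
    (LpContractivity.lpBallProj_spec μ H hp) j hj_dense a ha_cont ha_ell S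
    (LpContractivity.mem_graph_iff_of_generator_eq j hj_inj hj_dense a hS)).trans
    (LpContractivity.exists_lpBallProj_iff hp j hj_inj a))
  constructor
  · exact fun h x hx t ht => (LpContractivity.contraction_iff_mapsTo_lpBall hp _).1
      (fun u hu => h u hu t ht) x hx
  · exact fun h u hu t ht => (LpContractivity.contraction_iff_mapsTo_lpBall hp _).2
      (fun u hu => h u hu t ht) u hu
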